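/- Let $q$ be a prime power of the form $q=1+3a^{2}$ with $a$ an integer, such that $l=\frac{q-1}{6}$ is an integer and $2$ is a cube in the finite field $\mathbb{F}_q$. Let $\gamma$ be a generator of $\mathbb{F}_q^{*}$, let $H=\langle\tau\rangle$ be the cyclic group of order $l$ acting on the additive group of $\mathbb{F}_q$ by letting $\tau$ act as multiplication by $\gamma^{6}$, and let $G=\mathbb{F}_q\rtimes H$ be the corresponding semidirect product (of order $q\,l$), in which $\tau x\tau^{-1}=\gamma^{6}x$ for $x\in\mathbb{F}_q$. Let $D_3^{6}=\gamma^{3}\langle\gamma^{6}\rangle\subset\mathbb{F}_q^{*}$, let $S=-1+D_3^{6}=\{-1+x\mid x\in D_3^{6}\}\subset\mathbb{F}_q$, and let $E=SH=\{xh\mid x\in S,\ h\in H\}\subset G$. Then $E$ generates $G$, and the Cayley digraph $\mathrm{Cay}(G,E)$ with vertex set $G$, in which $g\to h$ if and only if $g^{-1}h\in E$, is a directed strongly regular graph with parameters $$(v,k,t,\lambda,\mu)=\left(q\,\tfrac{q-1}{6},\ \left(\tfrac{q-1}{6}\right)^{2},\ \tfrac{(q-1)^{2}}{216},\ \tfrac{(q-1)^{2}}{216}-\tfrac{q-1}{36},\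 \tfrac{(q-1)^{2}}{216}\right).$$ That is, these five numbers are non-negative integers, the digraph has no loops and has $v$ vertices, and its adjacency matrix $A$ satisfies $A^{2}=tI+\lambda A+\mu(J-I-A)$ and $AJ=JA=kJ$, where $I$ is the identity matrix and $J$ the all-ones matrix. -/

import Mathlib

namespace DSRG

open scoped Classical in
/-- The adjacency matrix of a digraph. -/
noncomputable def adjMatrix {V : Type*} (Γ : Digraph V) : Matrix V V ℤ :=
  Matrix.of fun x y => if Γ.Adj x y then 1 else 0

/-- The all-ones matrix. -/
def allOnes (V : Type*) : Matrix V V ℤ := Matrix.of fun _ _ => 1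

open scoped Classical in
/-- A loopless digraph `Γ` on a finite vertex set is directed strongly regular with parameters
`(v, k, t, lam, mu)` if it has `v` vertices and its adjacency matrix `A` satisfies
`A² = t I + lam A + mu (J - I - A)` and `A J = J A = k J`. -/
structure IsDirectedStronglyRegular {V : Type*} [Fintype V] (Γ : Digraph V)
    (v k t lam mu : ℕ) : Prop where
  loopless : ∀ x, ¬ Γ.Adj x x
  card_eq : Fintype.card V = v
  sq_eq : adjMatrix Γ * adjMatrix Γ =
    (t : ℤ) • (1 : Matrix V V ℤ) + (lam : ℤ) • adjMatrix Γ
      + (mu : ℤ) • (allOnes V - 1 - adjMatrix Γ)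
  mul_allOnes : adjMatrix Γ * allOnes V = (k : ℤ) • allOnes V
  allOnes_mul : allOnes V * adjMatrix Γ = (k : ℤ) • allOnes V

/-- The directed Cayley graph: `g → h` if and only if `g⁻¹ h ∈ E`. -/
def cay {G : Type*} [Group G] (E : Set G) : Digraph G where
  Adj g h := g⁻¹ * h ∈ E

section

variable {F : Type*} [Field F]

/-- The cyclotomic class `D_i^e = γ^i ⟨γ^e⟩` of order `e` with respect to `γ`. -/
def cyclotomicClass (γ : Fˣ) (e i : ℕ) : Set F :=
  {x | ∃ u ∈ Subgroup.zpowers (γ ^ e), x = ((γ ^ i * u : Fˣ) : F)}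

/-- The action of `Fˣ` on the additive group of `F`, `u` acting as `x ↦ u x`. -/
def scaling (F : Type*) [Field F] : Fˣ →* MulAut (Multiplicative F) :=
  (MulAutMultiplicative F).symm.toMonoidHom.comp (DistribMulAction.toAddAut Fˣ F)

/-- The cyclic group `H = ⟨τ⟩`, `τ = γ^e`. -/
abbrev cyclicPart (γ : Fˣ) (e : ℕ) : Type _ := Subgroup.zpowers (γ ^ e)

/-- The semidirect product `F ⋊ H` of the additive group of `F` with `H = ⟨τ⟩`, in which
`τ x τ⁻¹ = γ^e x` for `x ∈ F`. -/
abbrev affineGroup (γ : Fˣ) (e : ℕ) : Type _ :=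
  Multiplicative F ⋊[(scaling F).comp (Subgroup.zpowers (γ ^ e)).subtype] cyclicPart γ e

/-- The action in `affineGroup` is multiplication by the corresponding element of `F`. -/
theorem scaling_apply (u : Fˣ) (x : F) :
    scaling F u (Multiplicative.ofAdd x) = Multiplicative.ofAdd ((u : F) * x) := rfl

noncomputable instance affineGroup.fintype [Finite F] (γ : Fˣ) (e : ℕ) :
    Fintype (affineGroup γ e) :=
  letI : Finite (affineGroup γ e) :=
    Finite.of_equiv (Multiplicative F × cyclicPart γ e) SemidirectProduct.equivProd.symm
  Fintype.ofFinite _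

/-- The subset `S H = {x h | x ∈ S, h ∈ H}` of `F ⋊ H`, for `S ⊆ F`. -/
def setMulH (γ : Fˣ) (e : ℕ) (S : Set F) : Set (affineGroup γ e) :=
  {g | ∃ x ∈ S, ∃ h : cyclicPart γ e,
    g = SemidirectProduct.inl (Multiplicative.ofAdd x) * SemidirectProduct.inr h}

end

end DSRG

/-!
Write `n = l / 6`, let `C_i` be the cyclotomic classes of order six and `H = ⟨γ⁶⟩`.

In the group ring of `F ⋊ H`, the square of `E = S H` is `S · (∑ₕ h S) · H`, and `∑ₕ h S` has
constant coefficient `|S ∩ C_i|` on `C_i`. The digraph is therefore directed strongly regular with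
the stated parameters once `|S ∩ C_i| = n` for all `i`: the coefficient of `x` in `E²` is then
`n l` if `x ∉ E` and `n (l - 1)` if `x ∈ E` (`ncard_factorizations_setMulH`,
`isDirectedStronglyRegular_cay`). These coefficients are positive, so `E` generates the group.

The equidistribution of `S = -1 + C_3` (`card_inter_shift_cyclotomicClass`) is a statement about
Jacobi sums. If `χ` is a complex character of order six, Fourier inversion expresses
`36 |S ∩ C_i|` by the sums `∑ₖ (-1)ᵏ J(χʲ, χᵏ)`, and those with `j ≠ 0` have to vanish. As `2` is
a cube and `q ≡ 1 (mod 12)`, `χ` is `1` at `4` and at `-1`. The duplication formula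
`J(ψ, ψ) = ψ(4)⁻¹ J(ψ, χ³)` and `J(ψ, φ) = ψ(-1) J(ψ, (ψ φ)⁻¹)` then reduce all nontrivial terms
to the cubic Jacobi sum `J = J(χ², χ²)` and its conjugate, and what remains to be shown is
`J + J̄ = -2` (`jacobiSum_add_jacobiSum_sq`).

This is where `q = 1 + 3 a²` enters. As `2` is a cube, `J = s + t √-3` with integers `s` and `t`
(`even_cubicCount`). Moreover `s² + 3 t² = q` and `s ≡ -1 (mod 3)`. Here `-3` is a square modulo
the characteristic `p`, so `p ≡ 1 (mod 3)`, and `J` is not divisible by `p` because its reduction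
is, up to sign, a binomial coefficient without carries (`cubicCount_not_all_congruent`). Primitive
representations of a prime power by `s² + 3 t²` are unique up to signs
(`sq_eq_one_of_prime_pow`), hence `s² = 1` and `s = -1`.
-/

namespace DSRG

/-! ### Identities between Jacobi sums -/

section Jacobi

variable {F R : Type*} [Field F] [Fintype F] [CommRing R]

/-- The substitution `x ↦ x / (x - 1)` in `∑ a(x) b(1 - x)`. -/
theorem jacobiSum_eq_of_mul_mul_eq_one {a b c : MulChar F R} (ha : a (-1) = 1)
    (habc : a * b * c = 1) : jacobiSum a b = jacobiSum a c := by
  classical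
  have hc : c = a⁻¹ * b⁻¹ := by rw [← mul_inv, eq_inv_of_mul_eq_one_right habc]
  unfold jacobiSum
  rw [← Finset.sum_erase Finset.univ (a := (1 : F)) (by simp [b.map_zero]),
    ← Finset.sum_erase (s := Finset.univ) (f := fun x => a x * c (1 - x)) (a := (1 : F))
      (by simp [c.map_zero])]
  refine Finset.sum_nbij' (fun x => x / (x - 1)) (fun x => x / (x - 1)) ?_ ?_ ?_ ?_ ?_
  · intro x hx
    have hx1 : x - 1 ≠ 0 := sub_ne_zero.mpr (by simpa using hx)
    have hne : x ≠ x - 1 := fun h => one_ne_zero (by linear_combination h)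
    simpa [div_eq_iff hx1] using hne
  · intro x hx
    have hx1 : x - 1 ≠ 0 := sub_ne_zero.mpr (by simpa using hx)
    have hne : x ≠ x - 1 := fun h => one_ne_zero (by linear_combination h)
    simpa [div_eq_iff hx1] using hne
  · intro x hx
    have hx1 : x - 1 ≠ 0 := sub_ne_zero.mpr (by simpa using hx)
    have : x / (x - 1) - 1 = (x - 1)⁻¹ := by field_simp; ring
    simp only [this]; field_simp
  · intro x hx
    have hx1 : x - 1 ≠ 0 := sub_ne_zero.mpr (by simpa using hx)
    have : x / (x - 1) - 1 = (x - 1)⁻¹ := by field_simp; ring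
    simp only [this]; field_simp
  · intro x hx
    have hx1 : x - 1 ≠ 0 := sub_ne_zero.mpr (by simpa using hx)
    have hx2 : 1 - x ≠ 0 := by rwa [← neg_sub, neg_ne_zero]
    have h1 : 1 - x / (x - 1) = (1 - x)⁻¹ := by
      refine eq_inv_of_mul_eq_one_left ?_
      field_simp; ring
    have h2 : x / (x - 1) = -1 * x * (1 - x)⁻¹ := by field_simp; ring
    have hu : a ((1 - x)⁻¹) * a (1 - x) = 1 := by
      rw [← map_mul, inv_mul_cancel₀ hx2, map_one]
    simp only [h1, hc, MulChar.mul_apply, MulChar.inv_apply', inv_inv]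
    rw [h2, map_mul, map_mul, ha]
    linear_combination (-(a x * b (1 - x))) * hu

/-- The quadratic character of `F` with values in `R`. -/
noncomputable def quadChar (F R : Type*) [Field F] [Fintype F] [CommRing R] : MulChar F R :=
  letI := Classical.decEq F
  (quadraticChar F).ringHomComp (Int.castRingHom R)

theorem quadChar_apply [DecidableEq F] (x : F) :
    quadChar F R x = ((quadraticChar F x : ℤ) : R) := by
  unfold quadChar
  simp only [MulChar.ringHomComp_apply, eq_intCast]
  congr!

/-- The case `ψ(4) = 1` of the duplication formula `J(ψ,ψ) = ψ(4)⁻¹ J(ψ,φ)` with `φ` quadratic: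
completing the square turns `x(1 - x)` into `(1 - w²) / 4`, and the square roots of `y` are
counted by `1 + φ(y)`. -/
theorem jacobiSum_self_eq [IsDomain R] (hF : ringChar F ≠ 2) {ψ : MulChar F R} (hψ : ψ ≠ 1)
    (h4 : ψ 4 = 1) : jacobiSum ψ ψ = jacobiSum ψ (quadChar F R) := by
  classical
  have h2 : (2 : F) ≠ 0 := Ring.two_ne_zero hF
  have e1 : jacobiSum ψ ψ = ∑ w : F, ψ (1 - w ^ 2) := by
    unfold jacobiSum
    refine Fintype.sum_equiv ((Equiv.mulLeft₀ (2 : F) h2).trans (Equiv.subRight 1)) _ _ fun x => ?_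
    rw [← map_mul, ← one_mul (ψ (x * (1 - x))), ← h4, ← map_mul]
    congr 1
    simp [Equiv.subRight]
    ring
  have e2 : ∑ w : F, ψ (1 - w ^ 2) = ∑ y : F, (quadChar F R y + 1) * ψ (1 - y) := by
    rw [← Finset.sum_fiberwise' Finset.univ (fun w : F => w ^ 2) (fun y => ψ (1 - y))]
    refine Finset.sum_congr rfl fun y _ => ?_
    rw [Finset.sum_const, nsmul_eq_mul]
    congr 1
    have := quadraticChar_card_sqrts hF y
    have h' := congrArg (Int.cast : ℤ → R) this
    rw [Int.cast_add, Int.cast_one, Int.cast_natCast] at h'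
    convert h' using 3
    · ext; simp
    · exact quadChar_apply y
  have e3 : ∑ y : F, ψ (1 - y) = 0 := by
    rw [← MulChar.sum_eq_zero_of_ne_one hψ]
    exact Fintype.sum_equiv (Equiv.subLeft 1) _ _ fun y => rfl
  rw [e1, e2, jacobiSum_comm]
  simp only [add_mul, one_mul, Finset.sum_add_distrib, e3, add_zero, jacobiSum]

end Jacobi

/-! ### Cyclotomic classes and characters -/

section Classes

variable {F R : Type*} [Field F] [Field R]

theorem zero_notMem_cyclotomicClass (γ : Fˣ) (e i : ℕ) : (0 : F) ∉ cyclotomicClass γ e i := by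
  rintro ⟨u, -, h⟩
  exact (Units.ne_zero _) h.symm

/-- A character sending the generator to a primitive `e`-th root of unity separates the cyclotomic
classes of order `e`. -/
theorem mem_cyclotomicClass_iff {γ : Fˣ} (hγ : ∀ u : Fˣ, u ∈ Subgroup.zpowers γ) {e : ℕ} {ζ : R}
    (hζ : IsPrimitiveRoot ζ e) (he : e ≠ 0) {χ : MulChar F R} (hχ : χ γ = ζ) {x : F} (hx : x ≠ 0)
    (i : ℕ) : x ∈ cyclotomicClass γ e i ↔ χ x = ζ ^ i := by
  have hz : ζ ≠ 0 := hζ.ne_zero he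
  have key : ∀ n : ℤ, χ ((γ ^ n : Fˣ) : F) = ζ ^ n := by
    intro n
    have h := map_zpow χ.toUnitHom γ n
    rw [← MulChar.coe_toUnitHom, h, Units.val_zpow_eq_zpow_val, MulChar.coe_toUnitHom, hχ]
  obtain ⟨n, hn⟩ := Subgroup.mem_zpowers_iff.mp (hγ (Units.mk0 x hx))
  have hxn : x = ((γ ^ n : Fˣ) : F) := by rw [hn]; rfl
  constructor
  · rintro ⟨u, hu, rfl⟩
    obtain ⟨k, rfl⟩ := Subgroup.mem_zpowers_iff.mp hu
    have : γ ^ i * (γ ^ e) ^ k = γ ^ ((i : ℤ) + e * k) := by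
      rw [zpow_add, zpow_mul, zpow_natCast, zpow_natCast]
    rw [this, key, zpow_add₀ hz, zpow_mul, zpow_natCast, zpow_natCast, hζ.pow_eq_one, one_zpow,
      mul_one]
  · intro h
    rw [hxn, key] at h
    have h1 : ζ ^ (n - i) = 1 := by
      rw [zpow_sub₀ hz, h, zpow_natCast, div_self (pow_ne_zero _ hz)]
    obtain ⟨k, hk⟩ := (hζ.zpow_eq_one_iff_dvd _).mp h1
    refine ⟨(γ ^ e) ^ k, Subgroup.zpow_mem_zpowers _ _, ?_⟩
    rw [hxn]
    congr 1
    rw [← zpow_natCast, ← zpow_natCast γ e, ← zpow_mul, ← zpow_add, ← hk]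
    congr 1; ring

open scoped Classical in
/-- Fourier inversion on `Fˣ ⧸ ⟨γ ^ e⟩`: the indicator of a cyclotomic class as a combination of
characters. -/
theorem sum_pow_apply_mul_eq_indicator {γ : Fˣ} (hγ : ∀ u : Fˣ, u ∈ Subgroup.zpowers γ) {e : ℕ}
    {ζ : R} (hζ : IsPrimitiveRoot ζ e) (he : e ≠ 0) {χ : MulChar F R} (hχ : χ γ = ζ)
    (hχe : χ ^ e = 1) (x : F) (i : ℕ) :
    ∑ j ∈ Finset.range e, (χ ^ j) x * ((ζ ^ i)⁻¹) ^ j =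
      if x ∈ cyclotomicClass γ e i then (e : R) else 0 := by
  by_cases hx : x = 0
  · subst hx
    rw [if_neg (zero_notMem_cyclotomicClass γ e i)]
    exact Finset.sum_eq_zero fun j _ => by rw [MulChar.map_zero, zero_mul]
  have hpow : ∀ j : ℕ, (χ ^ j) x = χ x ^ j := fun j => MulChar.pow_apply_coe χ j (Units.mk0 x hx)
  have hz : ζ ^ i ≠ 0 := pow_ne_zero _ (hζ.ne_zero he)
  simp only [hpow, ← mul_pow]
  rw [mem_cyclotomicClass_iff hγ hζ he hχ hx]
  split_ifs with h
  · simp [h, mul_inv_cancel₀ hz]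
  · set z := χ x * (ζ ^ i)⁻¹ with hzdef
    have hz1 : z ≠ 1 := fun h1 => h (by rwa [hzdef, mul_inv_eq_one₀ hz] at h1)
    have hze : z ^ e = 1 := by
      rw [hzdef, mul_pow, ← hpow, hχe, inv_pow, ← pow_mul, mul_comm i, pow_mul, hζ.pow_eq_one,
        one_pow, inv_one, mul_one]
      exact MulChar.one_apply_coe (Units.mk0 x hx)
    rw [geom_sum_eq hz1, hze, sub_self, zero_div]

open scoped Classical in
theorem pow_apply_eq_sum_indicator {γ : Fˣ} (hγ : ∀ u : Fˣ, u ∈ Subgroup.zpowers γ) {e : ℕ}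
    {ζ : R} (hζ : IsPrimitiveRoot ζ e) (he : e ≠ 0) {χ : MulChar F R} (hχ : χ γ = ζ)
    (hχe : χ ^ e = 1) (k : ℕ) (x : F) :
    (χ ^ k) x = ∑ i ∈ Finset.range e, if x ∈ cyclotomicClass γ e i then ζ ^ (k * i) else 0 := by
  by_cases hx : x = 0
  · subst hx
    simp [zero_notMem_cyclotomicClass, MulChar.map_zero]
  have hpow : ∀ j : ℕ, (χ ^ j) x = χ x ^ j := fun j => MulChar.pow_apply_coe χ j (Units.mk0 x hx)
  have hxe : χ x ^ e = 1 := by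
    rw [← hpow, hχe]; exact MulChar.one_apply_coe (Units.mk0 x hx)
  have : NeZero e := ⟨he⟩
  obtain ⟨i, hi, hxi⟩ := hζ.eq_pow_of_pow_eq_one hxe
  rw [Finset.sum_eq_single i]
  · rw [if_pos ((mem_cyclotomicClass_iff hγ hζ he hχ hx i).mpr hxi.symm), hpow, ← hxi, ← pow_mul,
      mul_comm]
  · intro j hj hji
    rw [if_neg]
    intro h
    rw [mem_cyclotomicClass_iff hγ hζ he hχ hx, ← hxi] at h
    exact hji (hζ.pow_inj (Finset.mem_range.mp hj) hi h.symm)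
  · intro h
    exact absurd (Finset.mem_range.mpr hi) h

open scoped Classical in
/-- The number of `x` for which `x (1 - x)` lies in the cubic class `C_i`. The Jacobi sum of a
cubic character with itself is read off from these three integers, whatever the field of values. -/
noncomputable def cubicCount [Fintype F] (γ : Fˣ) (i : ℕ) : ℕ :=
  (Finset.univ.filter fun x : F => x * (1 - x) ∈ cyclotomicClass γ 3 i).card

theorem jacobiSum_pow_eq_cubicCount [Fintype F] {γ : Fˣ} (hγ : ∀ u : Fˣ, u ∈ Subgroup.zpowers γ)
    {ζ : R} (hζ : IsPrimitiveRoot ζ 3) {χ : MulChar F R} (hχ : χ γ = ζ) (hχ3 : χ ^ 3 = 1) (k : ℕ) :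
    jacobiSum (χ ^ k) (χ ^ k) =
      cubicCount γ 0 + cubicCount γ 1 * ζ ^ k + cubicCount γ 2 * ζ ^ (2 * k) := by
  classical
  unfold jacobiSum
  simp_rw [← map_mul, pow_apply_eq_sum_indicator hγ hζ three_ne_zero hχ hχ3]
  rw [Finset.sum_comm]
  simp [Finset.sum_range_succ, ← Finset.sum_filter, cubicCount, mul_comm]

/-- A primitive root of unity of order dividing `#Fˣ` is the value at `γ` of a character of that
order. -/
theorem exists_mulChar_apply_generator [Fintype F] {γ : Fˣ}
    (hγ : ∀ u : Fˣ, u ∈ Subgroup.zpowers γ) {e : ℕ} {ζ : R} (hζ : IsPrimitiveRoot ζ e)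
    (he : e ≠ 0) (hdvd : e ∣ Fintype.card F - 1) :
    ∃ χ : MulChar F R, χ γ = ζ ∧ χ ^ e = 1 := by
  classical
  have hz : ζ ≠ 0 := hζ.ne_zero he
  have hmem : Units.mk0 ζ hz ∈ rootsOfUnity (Fintype.card Fˣ) R := by
    rw [mem_rootsOfUnity, Units.ext_iff, Fintype.card_units]
    obtain ⟨k, hk⟩ := hdvd
    simp [hk, pow_mul, hζ.pow_eq_one]
  have hspec := MulChar.ofRootOfUnity_spec hmem hγ
  refine ⟨MulChar.ofRootOfUnity hmem hγ, hspec, ?_⟩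
  rw [MulChar.eq_iff hγ, MulChar.pow_apply_coe, hspec, MulChar.one_apply_coe]
  exact hζ.pow_eq_one

end Classes

/-! ### Arithmetic of `q = s² + 3 t²` -/

/-- No carries occur when `(pⁿ - 1) / 3` is added to itself in base `p ≡ 1 (mod 3)`. -/
theorem not_dvd_choose_two_mul {p : ℕ} (hp : p.Prime) (hp3 : p % 3 = 1) (n : ℕ) :
    ∀ m : ℕ, 3 * m + 1 = p ^ n → ¬ p ∣ (2 * m).choose m := by
  have := Fact.mk hp
  obtain ⟨c, hc⟩ : ∃ c, p = 3 * c + 1 := ⟨p / 3, by omega⟩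
  have hp2 := hp.two_le
  induction n with
  | zero =>
    intro m hm
    obtain rfl : m = 0 := by simpa using hm
    simpa using hp.one_lt.ne'
  | succ n ih =>
    intro m hm
    obtain ⟨m', hm'⟩ : ∃ m', p ^ n = 3 * m' + 1 := by
      refine ⟨p ^ n / 3, ?_⟩
      have : p ^ n % 3 = 1 := by rw [Nat.pow_mod, hp3]; simp
      omega
    have hmm : m = p * m' + c := by
      have : 3 * m + 1 = (3 * m' + 1) * p := by rw [hm, pow_succ, hm']
      have h2 : (3 * m' + 1) * p = 3 * (p * m') + p := by ring
      omega
    have hcp : c < p := by omega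
    have h2cp : 2 * c < p := by omega
    have hL := Choose.choose_modEq_choose_mod_mul_choose_div_nat (p := p) (n := 2 * m) (k := m)
    have d1 : 2 * m % p = 2 * c := by
      rw [hmm, show 2 * (p * m' + c) = 2 * c + p * (2 * m') by ring, Nat.add_mul_mod_self_left,
        Nat.mod_eq_of_lt h2cp]
    have d2 : 2 * m / p = 2 * m' := by
      rw [hmm, show 2 * (p * m' + c) = 2 * c + p * (2 * m') by ring,
        Nat.add_mul_div_left _ _ hp.pos, Nat.div_eq_of_lt h2cp, zero_add]
    have d3 : m % p = c := by
      rw [hmm, add_comm, Nat.add_mul_mod_self_left, Nat.mod_eq_of_lt hcp]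
    have d4 : m / p = m' := by
      rw [hmm, add_comm, Nat.add_mul_div_left _ _ hp.pos, Nat.div_eq_of_lt hcp, zero_add]
    rw [d1, d2, d3, d4] at hL
    intro hdvd
    have h := (hL.dvd_iff dvd_rfl).mp hdvd
    rcases hp.dvd_mul.mp h with h | h
    · have h' : p ∣ (2 * c).factorial :=
        h.trans ⟨c.factorial * (2 * c - c).factorial, by
          rw [← mul_assoc, Nat.choose_mul_factorial_mul_factorial (by omega)]⟩
      have := hp.dvd_factorial.mp h'
      omega
    · exact ih m' hm'.symm h

/-- Uniqueness, up to signs, of the primitive representation of a power of an odd prime by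
`s² + 3 t²`, for a power of the form `1 + 3 a²`. -/
theorem sq_eq_one_of_prime_pow {p : ℤ} (hp : Prime p) (hp2 : ¬ p ∣ 2) {n : ℕ} (hn : n ≠ 0)
    {s t a : ℤ} (hq : s ^ 2 + 3 * t ^ 2 = p ^ n) (ha : 1 + 3 * a ^ 2 = p ^ n) (hpos : 0 < p ^ n)
    (hst : ¬ (p ∣ s ∧ p ∣ t)) : s ^ 2 = 1 := by
  have hp3 : ¬ p ∣ 3 := by
    intro h
    have h1 : p ∣ 1 := by
      have := dvd_sub ((dvd_pow_self p hn)) (h.mul_right (a ^ 2))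
      rwa [← ha, add_sub_cancel_right] at this
    exact hp.not_dvd_one h1
  have hpa : ¬ p ∣ a := by
    intro h
    have h1 : p ∣ 1 := by
      have := dvd_sub ((dvd_pow_self p hn)) ((dvd_pow h two_ne_zero).mul_left 3)
      rwa [← ha, add_sub_cancel_right] at this
    exact hp.not_dvd_one h1
  have key : ∀ a' : ℤ, 1 + 3 * a' ^ 2 = p ^ n → p ^ n ∣ s * a' - t → s ^ 2 = 1 := by
    rintro a' ha' ⟨d, hd⟩
    have h1 : (s + 3 * t * a') ^ 2 + 3 * (s * a' - t) ^ 2 = (p ^ n) ^ 2 := by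
      linear_combination (1 + 3 * a' ^ 2) * hq + (p ^ n) * ha'
    rw [hd, mul_pow] at h1
    have hd0 : d = 0 := by
      by_contra hd0
      have : 1 ≤ d ^ 2 := by have := sq_pos_of_ne_zero hd0; omega
      nlinarith [sq_nonneg (s + 3 * t * a'), sq_pos_of_pos hpos]
    have ht : t = s * a' := by rw [hd0, mul_zero] at hd; linarith
    have : (s ^ 2 - 1) * p ^ n = 0 := by
      rw [ht] at hq
      linear_combination (-s ^ 2) * ha' + hq
    rcases mul_eq_zero.mp this with h | h
    · linarith
    · exact absurd h hpos.ne'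
  have hprod : p ^ n ∣ 3 * ((s * a - t) * (s * a - -t)) := ⟨s ^ 2 - 1, by
    linear_combination s ^ 2 * ha - hq⟩
  have hcop3 : IsCoprime (p ^ n) 3 := ((hp.coprime_iff_not_dvd).mpr hp3).pow_left
  have hprod := hcop3.dvd_of_dvd_mul_left hprod
  by_cases h : p ∣ s * a - t
  · by_cases h' : p ∣ s * a - -t
    · exfalso
      have h2s : p ∣ 2 * (s * a) := by
        have := dvd_add h h'
        rwa [show s * a - t + (s * a - -t) = 2 * (s * a) by ring] at this
      have hsa : p ∣ s * a := (hp.dvd_or_dvd h2s).resolve_left hp2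
      have hs : p ∣ s := (hp.dvd_or_dvd hsa).resolve_right hpa
      have ht : p ∣ t := by
        have := dvd_sub hsa h
        rwa [sub_sub_cancel] at this
      exact hst ⟨hs, ht⟩
    · have := (((hp.coprime_iff_not_dvd).mpr h').pow_left (m := n)).dvd_of_dvd_mul_right hprod
      exact key a ha this
  · have := (((hp.coprime_iff_not_dvd).mpr h).pow_left (m := n)).dvd_of_dvd_mul_left hprod
    refine key (-a) (by rw [neg_sq]; exact ha) ?_
    rw [← dvd_neg]
    convert this using 1
    ring

/-! ### The cubic Jacobi sum -/

section Cubic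

variable {F : Type*} [Field F] [Fintype F]

theorem sum_pow_eq_ite {i : ℕ} (hi : i ≠ 0) :
    ∑ x : F, x ^ i = if Fintype.card F - 1 ∣ i then -1 else 0 := by
  classical
  rw [← FiniteField.sum_pow_units F i, 
    ← Finset.sum_erase Finset.univ (f := fun x : F => x ^ i) (a := 0) (zero_pow hi)]
  symm
  refine Finset.sum_bij (fun u _ => (u : F)) ?_ ?_ ?_ ?_
  · intro u _; simp
  · intro u _ v _ h; exact Units.ext h
  · intro x hx
    exact ⟨Units.mk0 x (by simpa using hx), Finset.mem_univ _, rfl⟩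
  · intro u _; rfl

/-- The Jacobi sum of the cubic character `x ↦ x ^ (2 (q - 1) / 3)` with values in `F` itself:
expanding the power of `1 - x`, only the middle binomial coefficient survives. -/
theorem sum_pow_mul_one_sub_pow {m : ℕ} (hm : m ≠ 0) (hF : Fintype.card F - 1 = 3 * m) :
    ∑ x : F, x ^ (2 * m) * (1 - x) ^ (2 * m) = -((-1) ^ m * ((2 * m).choose m : F)) := by
  have h1 : ∀ x : F, x ^ (2 * m) * (1 - x) ^ (2 * m) =
      ∑ k ∈ Finset.range (2 * m + 1), ((-1) ^ k * ((2 * m).choose k : F)) * x ^ (2 * m + k) := by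
    intro x
    rw [show (1 - x) = -x + 1 by ring, add_pow, Finset.mul_sum]
    refine Finset.sum_congr rfl fun k _ => ?_
    rw [neg_pow x, pow_add]; ring
  simp_rw [h1]
  rw [Finset.sum_comm]
  simp_rw [← Finset.mul_sum]
  rw [Finset.sum_eq_single m]
  · rw [sum_pow_eq_ite (by omega), hF, if_pos ⟨1, by ring⟩]; ring
  · intro k hk hkm
    rw [sum_pow_eq_ite (by omega), hF, if_neg, mul_zero]
    rintro ⟨c, hc⟩
    have hk' := Finset.mem_range.mp hk
    -- `2m ≤ 2m + k ≤ 4m`, and `3m` is the only multiple of `3m` in this range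
    have hc1 : c < 2 := by by_contra h; nlinarith [Nat.pos_of_ne_zero hm]
    interval_cases c <;> omega
  · intro h; simp at h; omega

/-- If `-3` is a nonzero square modulo a prime `p > 3`, then `p ≡ 1 (mod 3)`. -/
theorem mod_three_eq_one_of_dvd {p : ℕ} (hp : p.Prime) (hp2 : p ≠ 2) (hp3 : p ≠ 3) {a : ℤ}
    (ha : (p : ℤ) ∣ 1 + 3 * a ^ 2) : p % 3 = 1 := by
  have := Fact.mk hp
  have h0 : (1 : ZMod p) + 3 * (a : ZMod p) ^ 2 = 0 := by
    have := (ZMod.intCast_zmod_eq_zero_iff_dvd _ p).mpr ha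
    exact_mod_cast this
  have h2 : (2 : ZMod p) ≠ 0 := by
    intro h
    have := (ZMod.natCast_eq_zero_iff 2 p).mp (by exact_mod_cast h)
    exact hp2 ((Nat.prime_dvd_prime_iff_eq hp Nat.prime_two).mp this)
  have h3 : (3 : ZMod p) ≠ 0 := by
    intro h
    have := (ZMod.natCast_eq_zero_iff 3 p).mp (by exact_mod_cast h)
    exact hp3 ((Nat.prime_dvd_prime_iff_eq hp Nat.prime_three).mp this)
  -- `3a` is a square root of `-3`, so `w = (-1 + 3a) / 2` is a primitive cube root of unity
  obtain ⟨w, hw⟩ : ∃ w : ZMod p, 2 * w = -1 + 3 * a := ⟨(-1 + 3 * a) / 2, by field_simp⟩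
  have hw1 : w ^ 2 + w + 1 = 0 := by
    have : (2 * 2) * (w ^ 2 + w + 1) = 0 := by
      linear_combination (2 * w + 3 * a + 1) * hw + 3 * h0
    exact (mul_eq_zero.mp this).resolve_left (mul_ne_zero h2 h2)
  have hne : w ≠ 1 := by
    rintro rfl
    exact h3 (by linear_combination hw1)
  have ho : orderOf w = 3 := by
    refine orderOf_eq_prime ?_ hne
    linear_combination (w - 1) * hw1
  have hw0 : w ≠ 0 := by rintro rfl; simp at hw1
  have hd : 3 ∣ p - 1 := ho ▸ orderOf_dvd_of_pow_eq_one (ZMod.pow_card_sub_one_eq_one hw0)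
  have := hp.two_le
  omega

/-- The involution `x ↦ 1 - x` has the single fixed point `1 / 2`, and `1 / 2 * (1 - 1 / 2)` is a
cube when `2` is. -/
theorem even_cubicCount {γ : Fˣ} (hγ : ∀ u : Fˣ, u ∈ Subgroup.zpowers γ) (hF : ringChar F ≠ 2)
    {ζ : ℂ} (hζ : IsPrimitiveRoot ζ 3) {χ : MulChar F ℂ} (hχ : χ γ = ζ) (h4 : χ 4 = 1) {i : ℕ}
    (hi : 0 < i) (hi3 : i < 3) : Even (cubicCount γ i) := by
  classical
  have h2 : (2 : F) ≠ 0 := Ring.two_ne_zero hF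
  rw [← ZMod.natCast_eq_zero_iff_even, cubicCount, Finset.cast_card]
  refine Finset.sum_involution (fun x _ => 1 - x) (fun _ _ => by decide) ?_ ?_ ?_
  · intro x hx _ hfix
    have hx' : x * (1 - x) ∈ cyclotomicClass γ 3 i := by simpa using hx
    have hne : x * (1 - x) ≠ 0 := fun h => zero_notMem_cyclotomicClass γ 3 i (h ▸ hx')
    rw [mem_cyclotomicClass_iff hγ hζ three_ne_zero hχ hne] at hx'
    have h1 : 4 * (x * (1 - x)) = 1 := by
      rw [hfix]
      have : 2 * x = 1 := by linear_combination -hfix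
      linear_combination (2 * x + 1) * this
    have h5 : χ (4 * (x * (1 - x))) = 1 := by rw [h1, map_one]
    rw [map_mul, h4, one_mul, hx'] at h5
    exact hζ.pow_ne_one_of_pos_of_lt hi.ne' hi3 h5
  · intro x hx
    simp only [Finset.mem_filter, Finset.mem_univ, true_and] at hx ⊢
    rwa [sub_sub_cancel, mul_comm]
  · intro x hx
    exact sub_sub_cancel 1 x

/-- The cubic Jacobi sum is not divisible by the characteristic `p`: its reduction in `F` is, up to
sign, the central binomial coefficient of `2 (q - 1) / 3`. -/
theorem cubicCount_not_all_congruent {γ : Fˣ} (hγ : ∀ u : Fˣ, u ∈ Subgroup.zpowers γ) {p : ℕ}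
    [CharP F p] (hp : p.Prime) (hp3 : p % 3 = 1) :
    ¬ ((cubicCount γ 0 : F) = cubicCount γ 1 ∧ (cubicCount γ 1 : F) = cubicCount γ 2) := by
  classical
  rintro ⟨h01, h12⟩
  obtain ⟨n, -, hcard⟩ := FiniteField.card F p
  have hmod : p ^ (n : ℕ) % 3 = 1 := by rw [Nat.pow_mod, hp3]; simp
  obtain ⟨m, hm⟩ : ∃ m, 3 * m + 1 = p ^ (n : ℕ) := ⟨p ^ (n : ℕ) / 3, by omega⟩
  have hF : Fintype.card F - 1 = 3 * m := by omega
  have hm0 : m ≠ 0 := by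
    have := Fintype.one_lt_card (α := F)
    omega
  have ho : orderOf γ = 3 * m := by
    rw [orderOf_eq_card_of_forall_mem_zpowers hγ, Nat.card_eq_fintype_card, Fintype.card_units, hF]
  have hprim : IsPrimitiveRoot ((γ : F) ^ m) 3 := by
    have h1 : IsPrimitiveRoot (γ : F) (3 * m) := by
      rw [← ho, ← orderOf_units]
      exact IsPrimitiveRoot.orderOf _
    exact h1.pow (by omega) (mul_comm _ _)
  obtain ⟨χ, hχ, hχ3⟩ := exists_mulChar_apply_generator hγ hprim three_ne_zero ⟨m, hF⟩
  have hχx : ∀ x : F, (χ ^ 2) x = x ^ (2 * m) := by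
    intro x
    by_cases hx : x = 0
    · rw [hx, MulChar.map_zero, zero_pow (by omega)]
    · obtain ⟨k, hk⟩ := (mem_powers_iff_mem_zpowers.mpr (hγ (Units.mk0 x hx)))
      have hk' : x = (γ : F) ^ k := by
        have := congrArg Units.val hk
        simpa using this.symm
      rw [hk', MulChar.pow_apply' _ two_ne_zero, map_pow, hχ, ← pow_mul, ← pow_mul, ← pow_mul]
      congr 1; ring
  have hJ := jacobiSum_pow_eq_cubicCount hγ hprim hχ hχ3 2
  have hS : jacobiSum (χ ^ 2) (χ ^ 2) = -((-1) ^ m * ((2 * m).choose m : F)) := by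
    rw [← sum_pow_mul_one_sub_pow hm0 hF, jacobiSum]
    simp only [hχx]
  set z := (γ : F) ^ m
  have hz : z ^ 2 + z + 1 = 0 := by
    have h := hprim.geom_sum_eq_zero (by norm_num)
    simp only [Finset.sum_range_succ, Finset.sum_range_zero] at h
    linear_combination h
  have h0 : jacobiSum (χ ^ 2) (χ ^ 2) = 0 := by
    rw [hJ, h01, h12]
    linear_combination (cubicCount γ 2 : F) * (z ^ 2 - z + 1) * hz
  rw [h0] at hS
  have : ((2 * m).choose m : F) = 0 := by
    have h' := neg_eq_zero.mp hS.symm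
    exact (mul_eq_zero.mp h').resolve_left (pow_ne_zero _ (by simp))
  exact not_dvd_choose_two_mul hp hp3 n m hm ((CharP.cast_eq_zero_iff F p _).mp this)

/-- When `q = 1 + 3 a²` and `2` is a cube, the cubic Jacobi sum is `-1 + t √-3` with `t` an integer,
that is, its real part is `-1`. -/
theorem jacobiSum_add_jacobiSum_sq {γ : Fˣ} (hγ : ∀ u : Fˣ, u ∈ Subgroup.zpowers γ)
    (hF : ringChar F ≠ 2) {a : ℤ} (ha : (Fintype.card F : ℤ) = 1 + 3 * a ^ 2)
    {ζ : ℂ} (hζ : IsPrimitiveRoot ζ 3) {χ : MulChar F ℂ} (hχ : χ γ = ζ) (hχ3 : χ ^ 3 = 1)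
    (h4 : χ 4 = 1) : jacobiSum χ χ + jacobiSum (χ ^ 2) (χ ^ 2) = -2 := by
  classical
  obtain ⟨n, hp, hcard⟩ := FiniteField.card F (ringChar F)
  set p := ringChar F with hpdef
  have hJ := jacobiSum_pow_eq_cubicCount hγ hζ hχ hχ3
  have hz : ζ ^ 2 + ζ + 1 = 0 := by
    have h := hζ.geom_sum_eq_zero (by norm_num)
    simp only [Finset.sum_range_succ, Finset.sum_range_zero] at h
    linear_combination h
  have hζ3 : ζ ^ 3 = 1 := hζ.pow_eq_one
  have hζ2 : ζ ^ 2 = -1 - ζ := by linear_combination hz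
  have hζ4 : ζ ^ (2 * 2) = ζ := by linear_combination ζ * hζ3
  have hχ1 : χ ≠ 1 := by
    rintro rfl
    rw [MulChar.one_apply_coe] at hχ
    exact hζ.ne_one (by norm_num) hχ.symm
  have hχ2 : χ ^ 2 = χ⁻¹ := by
    rw [eq_inv_iff_mul_eq_one, ← pow_succ, hχ3]
  have hJ0 := hJ 0
  have hJ1 := hJ 1
  have hJ2 := hJ 2
  simp only [pow_zero, mul_zero, mul_one, pow_one, jacobiSum_one_one] at hJ0 hJ1
  have hnorm : jacobiSum χ χ * jacobiSum (χ ^ 2) (χ ^ 2) = Fintype.card F := by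
    rw [hχ2]
    refine jacobiSum_mul_jacobiSum_inv ?_ hχ1 hχ1 ?_
    · rw [ringChar.eq_zero]
      exact hp.ne_zero.symm
    · rw [← pow_two, hχ2]
      exact inv_ne_one.mpr hχ1
  rw [hJ1, hJ2] at hnorm ⊢
  obtain ⟨n1, hn1⟩ := (even_cubicCount hγ hF hζ hχ h4 one_pos (by norm_num)).two_dvd
  obtain ⟨n2, hn2⟩ := (even_cubicCount hγ hF hζ hχ h4 two_pos (by norm_num)).two_dvd
  have hnot := cubicCount_not_all_congruent (p := p) hγ hp
  generalize cubicCount γ 0 = N0 at *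
  generalize cubicCount γ 1 = N1 at *
  generalize cubicCount γ 2 = N2 at *
  subst hn1 hn2
  have hsum : (Fintype.card F : ℤ) - 2 = N0 + 2 * n1 + 2 * n2 := by
    have : (Fintype.card F : ℂ) - 2 = N0 + 2 * n1 + 2 * n2 := by
      rw [hJ0]; push_cast; ring
    exact_mod_cast this
  have hst : ((N0 : ℤ) - n1 - n2) ^ 2 + 3 * ((n1 : ℤ) - n2) ^ 2 = Fintype.card F := by
    have : ((N0 : ℂ) - n1 - n2) ^ 2 + 3 * ((n1 : ℂ) - n2) ^ 2 = Fintype.card F := by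
      rw [← hnorm]
      rw [hζ4, hζ2]
      push_cast
      linear_combination (2 * (n1 : ℂ) - 2 * n2) ^ 2 * hz
    exact_mod_cast this
  set s : ℤ := (N0 : ℤ) - n1 - n2 with hs
  set t : ℤ := (n1 : ℤ) - n2 with ht
  have hq3 : Fintype.card F % 3 = 1 := by omega
  have hpp : Prime (p : ℤ) := Nat.prime_iff_prime_int.mp hp
  have hp3 : p ≠ 3 := by
    intro h
    rw [hcard, h] at hq3
    rw [Nat.pow_mod] at hq3
    simp at hq3
  have hcard' : (Fintype.card F : ℤ) = (p : ℤ) ^ (n : ℕ) := by rw [hcard]; push_cast; rfl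
  have hpm : p % 3 = 1 := by
    refine mod_three_eq_one_of_dvd hp hF hp3 (a := a) ?_
    rw [← ha, hcard']
    exact dvd_pow_self _ n.ne_zero
  have hs1 : s ^ 2 = 1 := by
    refine sq_eq_one_of_prime_pow hpp ?_ n.ne_zero (hst.trans hcard') (ha.symm.trans hcard') ?_ ?_
    · intro h
      have : p ∣ 2 := by exact_mod_cast h
      exact hF ((Nat.prime_dvd_prime_iff_eq hp Nat.prime_two).mp this)
    · rw [← hcard']; exact_mod_cast Fintype.card_pos
    · rintro ⟨hps, hpt⟩
      have c1 : ((s : ℤ) : F) = 0 := (CharP.intCast_eq_zero_iff F p s).mpr hps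
      have c2 : ((t : ℤ) : F) = 0 := (CharP.intCast_eq_zero_iff F p t).mpr hpt
      rw [hs] at c1
      rw [ht] at c2
      push_cast at c1 c2
      refine hnot hpm ⟨?_, ?_⟩ <;> push_cast
      · linear_combination c1 - c2
      · linear_combination 2 * c2
  have hs2 : s = -1 := by
    rcases sq_eq_one_iff.mp hs1 with h | h
    · omega
    · exact h
  have hsC : (N0 : ℂ) - n1 - n2 = -1 := by
    have h := congrArg (Int.cast : ℤ → ℂ) hs2
    rw [hs] at h
    push_cast at h
    exact h
  rw [hζ4, hζ2]
  push_cast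
  linear_combination 2 * hsC

end Cubic

/-! ### The shifted sextic class `-1 + D₃` is equidistributed -/

section Sextic

variable {F : Type*} [Field F] [Fintype F]

/-- The cube of a character of order six is the quadratic character. -/
theorem pow_three_eq_quadChar {γ : Fˣ} (hγ : ∀ u : Fˣ, u ∈ Subgroup.zpowers γ) {ζ : ℂ}
    (hζ : IsPrimitiveRoot ζ 6) {χ : MulChar F ℂ} (hχ : χ γ = ζ) (hχ6 : χ ^ 6 = 1) :
    χ ^ 3 = quadChar F ℂ := by
  classical
  have h3 : ζ ^ 3 = -1 := by
    have h := hζ.pow_eq_one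
    have hne : ζ ^ 3 ≠ 1 := hζ.pow_ne_one_of_pos_of_lt (by norm_num) (by norm_num)
    have : (ζ ^ 3 - 1) * (ζ ^ 3 + 1) = 0 := by linear_combination h
    exact eq_neg_of_add_eq_zero_left ((mul_eq_zero.mp this).resolve_left (sub_ne_zero.mpr hne))
  rw [MulChar.eq_iff hγ, MulChar.pow_apply_coe, hχ, quadChar_apply, h3]
  have hns : ¬ IsSquare (γ : F) := by
    rintro ⟨y, hy⟩
    have hy0 : y ≠ 0 := by rintro rfl; simp at hy
    have h6 : χ y ^ 6 = 1 := by
      have := MulChar.pow_apply_coe χ 6 (Units.mk0 y hy0)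
      rw [hχ6, MulChar.one_apply_coe] at this
      exact this.symm
    rw [hy, map_mul] at hχ
    rw [← hχ] at h3
    have : (1 : ℂ) = -1 := by linear_combination h3 - h6
    norm_num at this
  rw [quadraticChar_neg_one_iff_not_isSquare.mpr hns]
  norm_num

theorem sum_pow_mul_pow_one_add_eq_jacobiSum {χ ψ : MulChar F ℂ} (hχ : χ (-1) = 1) :
    ∑ x : F, χ x * ψ (1 + x) = jacobiSum χ ψ := by
  unfold jacobiSum
  refine Fintype.sum_equiv (Equiv.neg F) _ _ fun x => ?_
  have h : χ (-x) = χ x := by rw [← neg_one_mul, map_mul, hχ, one_mul]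
  simp [h]

/-- For a sextic character `χ` with `χ(-1) = χ(4) = 1`, all `J(χʲ, χᵏ)`
with `χʲ`, `χᵏ`, `χʲ⁺ᵏ` nontrivial equal `J(χ², χ²)` or its conjugate. With
`J(χ², χ²) + J(χ⁴, χ⁴) = -2`, the alternating sums over `k` of `J(χʲ, χᵏ)` vanish for `0 < j < 6`. -/
theorem alternating_sum_jacobiSum_eq_zero {χ : MulChar F ℂ} (hF : ringChar F ≠ 2)
    (ho : orderOf χ = 6) (hneg : χ (-1) = 1) (h4 : χ 4 = 1) (hquad : χ ^ 3 = quadChar F ℂ)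
    (hre : jacobiSum (χ ^ 2) (χ ^ 2) + jacobiSum (χ ^ 4) (χ ^ 4) = -2) {j : ℕ} (hj : 0 < j)
    (hj6 : j < 6) :
    ∑ k ∈ Finset.range 6, (-1) ^ k * jacobiSum (χ ^ j) (χ ^ k) = 0 := by
  have hu : ∀ {x : F}, χ x = 1 → ∀ k : ℕ, (χ ^ k) x = 1 := by
    intro x hx k
    have hx0 : x ≠ 0 := by rintro rfl; rw [MulChar.map_zero] at hx; exact zero_ne_one hx
    have := MulChar.pow_apply_coe χ k (Units.mk0 x hx0)
    rw [Units.val_mk0, hx, one_pow] at this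
    exact this
  have hne : ∀ k : ℕ, ¬ 6 ∣ k → χ ^ k ≠ 1 := fun k hk h => hk (ho ▸ orderOf_dvd_of_pow_eq_one h)
  have hp : ∀ k : ℕ, 6 ∣ k → χ ^ k = 1 := fun k hk => orderOf_dvd_iff_pow_eq_one.mp (ho ▸ hk)
  have tri : ∀ a b c : ℕ, 6 ∣ a + b + c →
      jacobiSum (χ ^ a) (χ ^ b) = jacobiSum (χ ^ a) (χ ^ c) := by
    intro a b c h
    refine jacobiSum_eq_of_mul_mul_eq_one (hu hneg a) ?_
    rw [← pow_add, ← pow_add, hp _ h]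
  have dup : ∀ a : ℕ, ¬ 6 ∣ a → jacobiSum (χ ^ a) (χ ^ a) = jacobiSum (χ ^ a) (χ ^ 3) := by
    intro a h
    rw [hquad]
    exact jacobiSum_self_eq hF (hne a h) (hu h4 a)
  have com : ∀ a b : ℕ, jacobiSum (χ ^ a) (χ ^ b) = jacobiSum (χ ^ b) (χ ^ a) :=
    fun a b => jacobiSum_comm _ _
  have zer : ∀ a : ℕ, ¬ 6 ∣ a → jacobiSum (χ ^ a) (χ ^ 0) = -1 := by
    intro a h
    rw [com, pow_zero, jacobiSum_one_nontrivial (hne a h)]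
  have inv : ∀ a b : ℕ, ¬ 6 ∣ a → 6 ∣ a + b → jacobiSum (χ ^ a) (χ ^ b) = -1 := by
    intro a b h hab
    have : χ ^ b = (χ ^ a)⁻¹ := by
      rw [eq_inv_iff_mul_eq_one, ← pow_add, hp _ (by omega)]
    rw [this, jacobiSum_nontrivial_inv (hne a h), hu hneg a]
  have e23 : jacobiSum (χ ^ 2) (χ ^ 3) = jacobiSum (χ ^ 2) (χ ^ 2) := (dup 2 (by norm_num)).symm
  have e21 : jacobiSum (χ ^ 2) (χ ^ 1) = jacobiSum (χ ^ 2) (χ ^ 2) :=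
    (tri 2 1 3 (by norm_num)).trans e23
  have e13 : jacobiSum (χ ^ 1) (χ ^ 3) = jacobiSum (χ ^ 2) (χ ^ 2) :=
    (tri 1 3 2 (by norm_num)).trans ((com 1 2).trans e21)
  have e11 := (dup 1 (by norm_num)).trans e13
  have e14 := (tri 1 4 1 (by norm_num)).trans e11
  have e43 : jacobiSum (χ ^ 4) (χ ^ 3) = jacobiSum (χ ^ 4) (χ ^ 4) := (dup 4 (by norm_num)).symm
  have e45 : jacobiSum (χ ^ 4) (χ ^ 5) = jacobiSum (χ ^ 4) (χ ^ 4) :=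
    (tri 4 5 3 (by norm_num)).trans e43
  have e53 : jacobiSum (χ ^ 5) (χ ^ 3) = jacobiSum (χ ^ 4) (χ ^ 4) :=
    (tri 5 3 4 (by norm_num)).trans ((com 5 4).trans e45)
  have e55 := (dup 5 (by norm_num)).trans e53
  have e52 := (tri 5 2 5 (by norm_num)).trans e55
  simp only [Finset.sum_range_succ, Finset.sum_range_zero]
  interval_cases j
  · rw [zer 1 (by norm_num), e11, com 1 2, e21, e13, e14, inv 1 5 (by norm_num) (by norm_num)]
    ring
  · rw [zer 2 (by norm_num), e21, e23, inv 2 4 (by norm_num) (by norm_num), com 2 5, e52]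
    linear_combination -hre
  · rw [zer 3 (by norm_num), com 3 1, e13, com 3 2, e23, inv 3 3 (by norm_num) (by norm_num),
      com 3 4, e43, com 3 5, e53]
    ring
  · rw [zer 4 (by norm_num), com 4 1, e14, inv 4 2 (by norm_num) (by norm_num), e43, e45]
    linear_combination -hre
  · rw [zer 5 (by norm_num), inv 5 1 (by norm_num) (by norm_num), e52, e53, com 5 4, e45, e55]
    ring

theorem alternating_sum_jacobiSum_one {χ : MulChar F ℂ} (ho : orderOf χ = 6) :
    ∑ k ∈ Finset.range 6, (-1) ^ k * jacobiSum 1 (χ ^ k) = (Fintype.card F : ℂ) - 1 := by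
  have hk : ∀ k : ℕ, ¬ 6 ∣ k → jacobiSum 1 (χ ^ k) = -1 := fun k hk =>
    jacobiSum_one_nontrivial fun h => hk (ho ▸ orderOf_dvd_of_pow_eq_one h)
  simp only [Finset.sum_range_succ, Finset.sum_range_zero]
  rw [pow_zero χ, jacobiSum_one_one, hk 1 (by norm_num), hk 2 (by norm_num), hk 3 (by norm_num),
    hk 4 (by norm_num), hk 5 (by norm_num)]
  ring

open scoped Classical in
/-- Each sextic class contains the same number `(q - 1) / 36` of elements of `-1 + D₃`: in the
Fourier expansion of this number only the contribution of the trivial character survives. -/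
theorem card_inter_shift_cyclotomicClass {γ : Fˣ} (hγ : ∀ u : Fˣ, u ∈ Subgroup.zpowers γ) {a : ℤ}
    (ha : (Fintype.card F : ℤ) = 1 + 3 * a ^ 2) {l : ℕ} (hl : Fintype.card F - 1 = 6 * l)
    (h2 : ∃ y : F, y ^ 3 = 2) (i : ℕ) :
    6 * (Finset.univ.filter fun x : F =>
      x ∈ cyclotomicClass γ 6 i ∧ 1 + x ∈ cyclotomicClass γ 6 3).card = l := by
  have hcard := Fintype.one_lt_card (α := F)
  have hl0 : l ≠ 0 := by rintro rfl; omega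
  obtain ⟨l', hl'⟩ : Even l := by
    have h3 : (2 * l : ℤ) = a ^ 2 := by
      have : (Fintype.card F : ℤ) - 1 = 6 * l := by omega
      linarith
    have hae : Even a := by
      have : Even (a ^ 2) := ⟨l, by linarith⟩
      exact (Int.even_pow.mp this).1
    obtain ⟨b, rfl⟩ := hae
    have : (l : ℤ) = 2 * b ^ 2 := by linarith
    exact (Int.even_coe_nat l).mp ⟨b ^ 2, by linarith⟩
  have hF : ringChar F ≠ 2 := by
    intro h
    have := FiniteField.even_card_iff_char_two.mp h
    omega
  have hζ : IsPrimitiveRoot (Complex.exp (2 * Real.pi * Complex.I / (6 : ℕ))) 6 :=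
    Complex.isPrimitiveRoot_exp 6 (by norm_num)
  set ζ := Complex.exp (2 * Real.pi * Complex.I / (6 : ℕ))
  obtain ⟨χ, hχ, hχ6⟩ := exists_mulChar_apply_generator hγ hζ (by norm_num) ⟨l, hl⟩
  have hz3 : ζ ^ 3 = -1 := by
    have h := hζ.pow_eq_one
    have hne : ζ ^ 3 ≠ 1 := hζ.pow_ne_one_of_pos_of_lt (by norm_num) (by norm_num)
    have : (ζ ^ 3 - 1) * (ζ ^ 3 + 1) = 0 := by linear_combination h
    exact eq_neg_of_add_eq_zero_left ((mul_eq_zero.mp this).resolve_left (sub_ne_zero.mpr hne))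
  have ho : orderOf χ = 6 := by
    refine Nat.dvd_antisymm (orderOf_dvd_of_pow_eq_one hχ6) ?_
    refine (hζ.pow_eq_one_iff_dvd _).mp ?_
    rw [← hχ, ← MulChar.pow_apply_coe, pow_orderOf_eq_one, MulChar.one_apply_coe]
  have hneg : χ (-1) = 1 := by
    -- `-1 = γ ^ ((q - 1) / 2)`, and `(q - 1) / 2` is divisible by `6`
    have hoγ : orderOf (γ : F) = 6 * l := by
      rw [orderOf_units, orderOf_eq_card_of_forall_mem_zpowers hγ, Nat.card_eq_fintype_card,
        Fintype.card_units, hl]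
    have h1 : (γ : F) ^ (6 * l') ≠ 1 := by
      intro h
      have := Nat.le_of_dvd (by omega) (orderOf_dvd_of_pow_eq_one h)
      omega
    have h2 : ((γ : F) ^ (6 * l')) ^ 2 = 1 := by
      rw [← pow_mul, show 6 * l' * 2 = 6 * l by omega, ← hoγ, pow_orderOf_eq_one]
    rw [← (sq_eq_one_iff.mp h2).resolve_left h1, map_pow, hχ, pow_mul, hζ.pow_eq_one, one_pow]
  have h4 : χ 4 = 1 := by
    obtain ⟨y, hy⟩ := h2
    have hy0 : y ≠ 0 := by
      rintro rfl
      exact Ring.two_ne_zero hF (by simpa using hy.symm)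
    have h6 := MulChar.pow_apply_coe χ 6 (Units.mk0 y hy0)
    rw [hχ6, MulChar.one_apply_coe, Units.val_mk0, ← map_pow] at h6
    rw [h6]
    congr 1
    linear_combination (-y ^ 3 - 2) * hy
  have hre : jacobiSum (χ ^ 2) (χ ^ 2) + jacobiSum (χ ^ 4) (χ ^ 4) = -2 := by
    have h := jacobiSum_add_jacobiSum_sq (χ := χ ^ 2) hγ hF ha
      (hζ.pow (by norm_num) (by norm_num : 6 = 2 * 3)) (by rw [MulChar.pow_apply_coe, hχ])
      (by rw [← pow_mul, hχ6]) (by rw [MulChar.pow_apply' _ two_ne_zero, h4, one_pow])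
    rwa [← pow_mul] at h
  have hquad := pow_three_eq_quadChar hγ hζ hχ hχ6
  have hjneg : ∀ j : ℕ, (χ ^ j) (-1) = 1 := by
    intro j
    have := MulChar.pow_apply_coe χ j (-1)
    rwa [Units.val_neg, Units.val_one, hneg, one_pow] at this
  have hind := sum_pow_apply_mul_eq_indicator hγ hζ (by norm_num) hχ hχ6
  have main : (36 : ℂ) * (Finset.univ.filter fun x : F =>
      x ∈ cyclotomicClass γ 6 i ∧ 1 + x ∈ cyclotomicClass γ 6 3).card =
        (Fintype.card F : ℂ) - 1 := by
    calc (36 : ℂ) * (Finset.univ.filter fun x : F =>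
          x ∈ cyclotomicClass γ 6 i ∧ 1 + x ∈ cyclotomicClass γ 6 3).card
        = ∑ x : F, (∑ j ∈ Finset.range 6, (χ ^ j) x * ((ζ ^ i)⁻¹) ^ j) *
            ∑ k ∈ Finset.range 6, (χ ^ k) (1 + x) * ((ζ ^ 3)⁻¹) ^ k := by
          simp_rw [hind]
          rw [Finset.cast_card, Finset.sum_filter, Finset.mul_sum]
          refine Finset.sum_congr rfl fun x _ => ?_
          by_cases hA : x ∈ cyclotomicClass γ 6 i <;>
            by_cases hB : 1 + x ∈ cyclotomicClass γ 6 3 <;> simp [hA, hB]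
          norm_num
      _ = ∑ j ∈ Finset.range 6, ((ζ ^ i)⁻¹) ^ j *
            ∑ k ∈ Finset.range 6, (-1) ^ k * jacobiSum (χ ^ j) (χ ^ k) := by
          simp_rw [hz3, Finset.sum_mul_sum]
          rw [Finset.sum_comm]
          refine Finset.sum_congr rfl fun j _ => ?_
          rw [Finset.sum_comm, Finset.mul_sum]
          refine Finset.sum_congr rfl fun k _ => ?_
          rw [← sum_pow_mul_pow_one_add_eq_jacobiSum (hjneg j), Finset.mul_sum, Finset.mul_sum]
          refine Finset.sum_congr rfl fun x _ => ?_
          rw [show ((-1 : ℂ))⁻¹ = -1 by norm_num]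
          ring
      _ = (Fintype.card F : ℂ) - 1 := by
          rw [Finset.sum_eq_single 0]
          · rw [pow_zero, one_mul, pow_zero, alternating_sum_jacobiSum_one ho]
          · intro j hj hj0
            rw [alternating_sum_jacobiSum_eq_zero hF ho hneg h4 hquad hre
              (Nat.pos_of_ne_zero hj0) (Finset.mem_range.mp hj), mul_zero]
          · simp
  have hc : (Fintype.card F : ℂ) = 6 * l + 1 := by
    have : Fintype.card F = 6 * l + 1 := by omega
    exact_mod_cast this
  rw [hc] at main
  have : (6 : ℂ) * (Finset.univ.filter fun x : F =>
      x ∈ cyclotomicClass γ 6 i ∧ 1 + x ∈ cyclotomicClass γ 6 3).card = l := by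
    linear_combination main / 6
  exact_mod_cast this

end Sextic

/-! ### Cayley digraphs -/

section Cayley

variable {G : Type*} [Group G]

open scoped Classical in
theorem adjMatrix_cay_apply (E : Set G) (g h : G) :
    adjMatrix (cay E) g h = if g⁻¹ * h ∈ E then 1 else 0 := rfl

variable [Fintype G]

theorem adjMatrix_cay_sq_apply (E : Set G) (g h : G) :
    (adjMatrix (cay E) * adjMatrix (cay E)) g h =
      ({w | w ∈ E ∧ w⁻¹ * (g⁻¹ * h) ∈ E} : Set G).ncard := by
  classical
  rw [Matrix.mul_apply, Set.ncard_eq_toFinset_card', Finset.cast_card,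
    ← Equiv.sum_comp (Equiv.mulLeft g), Set.toFinset_ofPred, Finset.sum_filter]
  refine Finset.sum_congr rfl fun w _ => ?_
  simp only [adjMatrix_cay_apply, Equiv.coe_mulLeft, inv_mul_cancel_left, mul_inv_rev, mul_assoc]
  by_cases hw : w ∈ E <;> simp [hw]

theorem adjMatrix_cay_mul_allOnes (E : Set G) :
    adjMatrix (cay E) * allOnes G = (E.ncard : ℤ) • allOnes G := by
  classical
  ext g h
  rw [Matrix.mul_apply, Set.ncard_eq_toFinset_card', ← Equiv.sum_comp (Equiv.mulLeft g)]
  simp only [adjMatrix_cay_apply, allOnes, Matrix.of_apply, Matrix.smul_apply, smul_eq_mul, mul_one,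
    Equiv.coe_mulLeft, inv_mul_cancel_left, Finset.sum_boole, Set.filter_mem_univ_eq_toFinset]

theorem allOnes_mul_adjMatrix_cay (E : Set G) :
    allOnes G * adjMatrix (cay E) = (E.ncard : ℤ) • allOnes G := by
  classical
  ext g h
  rw [Matrix.mul_apply, Set.ncard_eq_toFinset_card', ← Equiv.sum_comp (Equiv.divLeft h)]
  simp only [adjMatrix_cay_apply, allOnes, Matrix.of_apply, Matrix.smul_apply, smul_eq_mul, mul_one,
    one_mul, Equiv.divLeft_apply, inv_div, div_mul_cancel, Finset.sum_boole, Set.filter_mem_univ_eq_toFinset]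

open scoped Classical in
/-- A Cayley digraph is directed strongly regular with `t = μ` and `λ = μ - n` as soon as the
number of factorizations `x = w w'` with `w, w' ∈ E` is `μ - n` for `x ∈ E` and `μ` otherwise. -/
theorem isDirectedStronglyRegular_cay {E : Set G} (h1 : (1 : G) ∉ E) {mu n : ℕ} (hn : n ≤ mu)
    (h : ∀ x : G, ({w | w ∈ E ∧ w⁻¹ * x ∈ E} : Set G).ncard + (if x ∈ E then n else 0) = mu) :
    IsDirectedStronglyRegular (cay E) (Fintype.card G) E.ncard mu (mu - n) mu where
  loopless x := by
    change ¬ (x⁻¹ * x ∈ E)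
    rwa [inv_mul_cancel]
  card_eq := rfl
  sq_eq := by
    ext g g'
    have h' := h (g⁻¹ * g')
    rw [adjMatrix_cay_sq_apply]
    have h'' : ((({w | w ∈ E ∧ w⁻¹ * (g⁻¹ * g') ∈ E} : Set G).ncard : ℕ) : ℤ) =
        mu - if g⁻¹ * g' ∈ E then (n : ℤ) else 0 := by
      rw [← h']; split_ifs <;> simp
    rw [h'']
    simp only [Matrix.add_apply, Matrix.smul_apply, Matrix.sub_apply, adjMatrix_cay_apply, allOnes,
      Matrix.of_apply, smul_eq_mul, Nat.cast_sub hn]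
    split_ifs <;> ring
  mul_allOnes := adjMatrix_cay_mul_allOnes E
  allOnes_mul := allOnes_mul_adjMatrix_cay E

end Cayley

/-! ### The connection set `S H` -/

section Affine

variable {F : Type*} [Field F] {γ : Fˣ} {e : ℕ}

theorem mem_setMulH_iff {S : Set F} {g : affineGroup γ e} :
    g ∈ setMulH γ e S ↔ Multiplicative.toAdd g.left ∈ S := by
  constructor
  · rintro ⟨x, hx, h, rfl⟩
    simpa using hx
  · intro h
    exact ⟨_, h, g.right, (SemidirectProduct.inl_left_mul_inr_right g).symm⟩

theorem toAdd_inv_mul_left (w x : affineGroup γ e) :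
    Multiplicative.toAdd (w⁻¹ * x).left =
      (((w.right : Fˣ)⁻¹ : Fˣ) : F) *
        (Multiplicative.toAdd x.left - Multiplicative.toAdd w.left) := by
  have h : Multiplicative.toAdd (w⁻¹ * x).left =
      (((w.right : Fˣ)⁻¹ : Fˣ) : F) * Multiplicative.toAdd w.left⁻¹ +
        (((w.right : Fˣ)⁻¹ : Fˣ) : F) * Multiplicative.toAdd x.left := rfl
  rw [h, toAdd_inv]; ring

theorem ncard_setMulH (S : Set F) :
    (setMulH γ e S).ncard = S.ncard * Nat.card (cyclicPart γ e) := by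
  rw [← Nat.card_coe_set_eq, ← Nat.card_coe_set_eq, ← Nat.card_prod]
  refine Nat.card_congr
    { toFun := fun g => (⟨_, mem_setMulH_iff.mp g.2⟩, g.1.right)
      invFun := fun p => ⟨⟨Multiplicative.ofAdd p.1.1, p.2⟩, mem_setMulH_iff.mpr p.1.2⟩
      left_inv := fun g => rfl
      right_inv := fun p => rfl }

open scoped Classical in
/-- If every nonzero `H`-orbit meets `S` in exactly `n` points, the factorizations of an element of
`F ⋊ H` in `S H · S H` are counted by `n |S|` off `S H` and by `n (|S| - 1)` on `S H`: a
factorization of `(u, τ)` amounts to some `s ∈ S` together with a point of `S` in the orbit of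
`u - s`. -/
theorem ncard_factorizations_setMulH [Finite F] {S : Set F} (h0 : (0 : F) ∉ S) {n : ℕ}
    (hS : ∀ d : F, d ≠ 0 →
      Nat.card {ρ : cyclicPart γ e // (((ρ : Fˣ)⁻¹ : Fˣ) : F) * d ∈ S} = n)
    (x : affineGroup γ e) :
    ({w | w ∈ setMulH γ e S ∧ w⁻¹ * x ∈ setMulH γ e S} : Set (affineGroup γ e)).ncard +
      (if x ∈ setMulH γ e S then n else 0) = S.ncard * n := by
  have := Fintype.ofFinite F
  set u : F := Multiplicative.toAdd x.left with hu
  have e1 : ({w | w ∈ setMulH γ e S ∧ w⁻¹ * x ∈ setMulH γ e S} : Set (affineGroup γ e)).ncard =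
      ∑ s : S, if u = s then 0 else n := by
    rw [← Nat.card_coe_set_eq]
    have eq : ({w | w ∈ setMulH γ e S ∧ w⁻¹ * x ∈ setMulH γ e S} : Set (affineGroup γ e)) ≃
        Σ s : S, {ρ : cyclicPart γ e // (((ρ : Fˣ)⁻¹ : Fˣ) : F) * (u - s) ∈ S} :=
      { toFun := fun w => ⟨⟨_, mem_setMulH_iff.mp w.2.1⟩, w.1.right,
          by have := mem_setMulH_iff.mp w.2.2; rwa [toAdd_inv_mul_left] at this⟩
        invFun := fun p => ⟨⟨Multiplicative.ofAdd p.1.1, p.2.1⟩, mem_setMulH_iff.mpr p.1.2,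
          by rw [mem_setMulH_iff, toAdd_inv_mul_left]; exact p.2.2⟩
        left_inv := fun w => rfl
        right_inv := fun p => rfl }
    rw [Nat.card_congr eq, Nat.card_sigma]
    refine Finset.sum_congr rfl fun s _ => ?_
    split_ifs with h
    · rw [h, sub_self]
      simp [h0]
    · exact hS _ (sub_ne_zero.mpr h)
  have e2 : (if x ∈ setMulH γ e S then n else 0) = ∑ s : S, if u = s then n else 0 := by
    rw [mem_setMulH_iff]
    split_ifs with h
    · rw [Finset.sum_eq_single (⟨u, h⟩ : S)]
      · simp
      · intro s _ hs
        exact if_neg fun h' => hs (Subtype.ext h'.symm)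
      · simp
    · symm
      exact Finset.sum_eq_zero fun s _ => if_neg fun h' => h (by rw [← hu, h']; exact s.2)
  rw [e1, e2, ← Finset.sum_add_distrib, Finset.sum_congr rfl (g := fun _ => n)]
  · rw [Finset.sum_const, smul_eq_mul, Finset.card_univ, ← Nat.card_eq_fintype_card,
      Nat.card_coe_set_eq]
  · intro s _
    split_ifs <;> simp

theorem cyclotomicClass_eq_range (γ : Fˣ) (e i : ℕ) :
    cyclotomicClass γ e i = Set.range fun u : cyclicPart γ e => ((γ ^ i * u : Fˣ) : F) := by
  ext x
  constructor
  · rintro ⟨u, hu, rfl⟩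
    exact ⟨⟨u, hu⟩, rfl⟩
  · rintro ⟨u, rfl⟩
    exact ⟨u, u.2, rfl⟩

theorem ncard_cyclotomicClass (γ : Fˣ) (e i : ℕ) :
    (cyclotomicClass γ e i : Set F).ncard = Nat.card (cyclicPart γ e) := by
  rw [cyclotomicClass_eq_range, ← Set.image_univ, Set.ncard_image_of_injective, Set.ncard_univ]
  intro u v h
  exact Subtype.ext (mul_left_cancel (Units.ext h))

/-- `H` acts simply transitively on each cyclotomic class. -/
theorem card_inv_mul_mem (S : Set F) (i : ℕ) :
    Nat.card {ρ : cyclicPart γ e // (((ρ : Fˣ)⁻¹ : Fˣ) : F) * (γ : F) ^ i ∈ S} =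
      (cyclotomicClass γ e i ∩ S).ncard := by
  rw [← Nat.card_coe_set_eq]
  refine Nat.card_congr (Equiv.ofBijective (fun ρ => ⟨_, ?_, ρ.2⟩) ⟨?_, ?_⟩)
  · exact ⟨_, inv_mem ρ.1.2, by push_cast; ring⟩
  · intro ρ σ h
    have h' := congrArg Subtype.val h
    simp only at h'
    have h'' := mul_right_cancel₀ (pow_ne_zero i γ.ne_zero) h'
    exact Subtype.ext (Subtype.ext (inv_injective (Units.ext h'')))
  · rintro ⟨x, ⟨u, hu, rfl⟩, hS⟩
    have hx : (((u⁻¹)⁻¹ : Fˣ) : F) * (γ : F) ^ i = ((γ ^ i * u : Fˣ) : F) := by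
      rw [inv_inv]; push_cast; ring
    exact ⟨⟨⟨u⁻¹, inv_mem hu⟩, by simpa only [hx] using hS⟩, Subtype.ext hx⟩

end Affine

end DSRG

theorem mainTheorem6 (F : Type*) [Field F] [Fintype F] (q : ℕ) (hq : Fintype.card F = q)
    (a : ℤ) (ha : (q : ℤ) = 1 + 3 * a ^ 2)
    (l : ℕ) (hl : q - 1 = 6 * l)
    (h2 : ∃ y : F, y ^ 3 = 2)
    (γ : Fˣ) (hγ : ∀ u : Fˣ, u ∈ Subgroup.zpowers γ)
    (S : Set F) (hS : S = {y | ∃ x ∈ DSRG.cyclotomicClass γ 6 3, y = -1 + x})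
    (E : Set (DSRG.affineGroup γ 6)) (hE : E = DSRG.setMulH γ 6 S) :
    Nat.card (DSRG.cyclicPart γ 6) = l ∧
    Subgroup.closure E = ⊤ ∧
    ∃ v k t lam mu : ℕ,
      (v : ℚ) = (q : ℚ) * (((q : ℚ) - 1) / 6) ∧
      (k : ℚ) = (((q : ℚ) - 1) / 6) ^ 2 ∧
      (t : ℚ) = ((q : ℚ) - 1) ^ 2 / 216 ∧
      (lam : ℚ) = ((q : ℚ) - 1) ^ 2 / 216 - ((q : ℚ) - 1) / 36 ∧
      (mu : ℚ) = ((q : ℚ) - 1) ^ 2 / 216 ∧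
      DSRG.IsDirectedStronglyRegular (DSRG.cay E) v k t lam mu := by
  classical
  subst hq hE
  have hcard := Fintype.one_lt_card (α := F)
  have ho : orderOf γ = 6 * l := by
    rw [orderOf_eq_card_of_forall_mem_zpowers hγ, Nat.card_eq_fintype_card, Fintype.card_units, hl]
  have hH : Nat.card (DSRG.cyclicPart γ 6) = l := by
    rw [Nat.card_zpowers, orderOf_pow_of_dvd (by norm_num) (by rw [ho]; exact ⟨l, rfl⟩), ho]
    omega
  have hSmem : ∀ y : F, y ∈ S ↔ 1 + y ∈ DSRG.cyclotomicClass γ 6 3 := by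
    intro y
    rw [hS]
    constructor
    · rintro ⟨x, hx, rfl⟩
      rwa [add_neg_cancel_left]
    · intro h
      exact ⟨_, h, (neg_add_cancel_left 1 y).symm⟩
  have hScard : S.ncard = l := by
    have : S = (fun x => -1 + x) '' (DSRG.cyclotomicClass γ 6 3 : Set F) := by
      rw [hS]; ext y; simp only [Set.mem_ofPred_eq, Set.mem_image, eq_comm]
    rw [this, Set.ncard_image_of_injective _ (add_right_injective (-1 : F)),
      DSRG.ncard_cyclotomicClass, hH]
  have h0 : (0 : F) ∉ S := by
    -- `1` lies in the class `D₀`, not in `D₃`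
    rw [hSmem, add_zero]
    rintro ⟨u, hu, h⟩
    obtain ⟨k, rfl⟩ := Subgroup.mem_zpowers_iff.mp hu
    have h' : γ ^ ((3 : ℤ) + 6 * k) = 1 := by
      rw [zpow_add, zpow_mul]
      exact Units.ext h.symm
    have := orderOf_dvd_iff_zpow_eq_one.mpr h'
    rw [ho] at this
    obtain ⟨c, hc⟩ := this
    push_cast at hc
    have : (6 : ℤ) ∣ 3 := ⟨l * c - k, by linear_combination hc⟩
    norm_num at this
  obtain ⟨n, hn, hSn⟩ : ∃ n : ℕ, l = 6 * n ∧ ∀ d : F, d ≠ 0 →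
      Nat.card {ρ : DSRG.cyclicPart γ 6 // (((ρ : Fˣ)⁻¹ : Fˣ) : F) * d ∈ S} = n := by
    have key := DSRG.card_inter_shift_cyclotomicClass hγ ha hl h2
    refine ⟨l / 6, by have := key 0; omega, fun d hd => ?_⟩
    obtain ⟨i, hi⟩ := mem_powers_iff_mem_zpowers.mpr (hγ (Units.mk0 d hd))
    have hi' : d = (γ : F) ^ i := by
      have := congrArg Units.val hi
      simpa using this.symm
    rw [hi', DSRG.card_inv_mul_mem, Set.ncard_eq_toFinset_card']
    have h6 := key i
    rw [Nat.eq_div_iff_mul_eq_left (by norm_num) ⟨_, h6.symm⟩, mul_comm, ← h6]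
    congr 2
    ext x
    simp [hSmem]
  have hn0 : 0 < n := by omega
  have hfac := DSRG.ncard_factorizations_setMulH h0 hSn
  rw [hScard] at hfac
  have hln : n < l * n := by nlinarith
  have hdsr := DSRG.isDirectedStronglyRegular_cay (E := DSRG.setMulH γ 6 S)
    (fun h => h0 (by simpa using DSRG.mem_setMulH_iff.mp h)) hln.le hfac
  have hqQ : (Fintype.card F : ℚ) = 36 * n + 1 := by
    have : Fintype.card F = 36 * n + 1 := by omega
    exact_mod_cast this
  refine ⟨hH, ?_, _, _, _, _, _, ?_, ?_, ?_, ?_, ?_, hdsr⟩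
  · -- every element is a product of two elements of `E`
    rw [eq_top_iff]
    intro x _
    have hx := hfac x
    have hne : ({w | w ∈ DSRG.setMulH γ 6 S ∧ w⁻¹ * x ∈ DSRG.setMulH γ 6 S} :
        Set (DSRG.affineGroup γ 6)).ncard ≠ 0 := by
      split_ifs at hx <;> omega
    obtain ⟨w, hw, hwx⟩ := Set.nonempty_of_ncard_ne_zero hne
    rw [← mul_inv_cancel_left w x]
    exact mul_mem (Subgroup.subset_closure hw) (Subgroup.subset_closure hwx)
  · rw [← Nat.card_eq_fintype_card, SemidirectProduct.card, hH, hn]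
    rw [Nat.card_congr Multiplicative.toAdd, Nat.card_eq_fintype_card]; push_cast; rw [hqQ]; ring
  · rw [DSRG.ncard_setMulH, hScard, hH, hn, hqQ]; push_cast; ring
  · rw [hqQ, hn]; push_cast; ring
  · rw [Nat.cast_sub hln.le, hqQ, hn]; push_cast; ring
  · rw [hqQ, hn]; push_cast; ring
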